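/- Let $p$ be an odd prime, and let $R$ be a complete discrete valuation ring with maximal ideal $pR$ and residue field $R/pR\cong\overline{\mathbb F}_p$ (an algebraic closure of $\mathbb F_p$). Let $\phi:R\to R$ be the ring homomorphism lifting the $p$-power Frobenius of $R/pR$, and let $\delta:R\to R$, $\delta x=\frac{\phi(x)-x^p}{p}$, be the corresponding $p$-derivation. A map $R^N\to R^M$ is called a $\delta$-map of order $r$ if it has the form $a\mapsto F(a,\delta a,\dots,\delta^r a)$, where $F$ is an $M$-tuple of restricted power series with coefficients in $R$ in $r+1$ $N$-tuples of variables (restricted means that the coefficients tend to $0$ $p$-adically, i.e. that the series lies in the $p$-adic completion of the polynomial ring over $R$). For affine smooth schemes $X,Y$ over $R$, a map $X(R)\to Y(R)$ is called a $\delta$-map if, for some closed embeddings $X\subset\mathbb A^N$, $Y\subset\mathbb A^M$ over $R$, it is induced by a $\delta$-map $R^N\to R^M$ of some finite order. A $\delta$-homomorphism $\mathbb G_m\to\mathbb G_a$ is a $\delta$-map $\omega:R^\times\to R$ with $\omega(ab)=\omega(a)+\omega(b)$ for all $a,b\in R^\times$. A classical $\delta$-cocycle $GL_n\to\mathfrak{gl}_n$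 is a $\delta$-map $f:GL_n(R)\to\mathfrak{gl}_n(R)$ such that $f(g_1g_2)=f(g_1)+g_1f(g_2)g_1^{-1}$ for all $g_1,g_2\in GL_n(R)$. **Theorem.** Let $f:GL_n\to\mathfrak{gl}_n$ be a classical $\delta$-cocycle. Then there exist a $\delta$-homomorphism $\omega:\mathbb G_m\to\mathbb G_a$ and a matrix $v\in\mathfrak{gl}_n(R)$ such that for all $g\in GL_n(R)$ $$f(g)=\omega(\det(g))\,1_n+gvg^{-1}-v.$$ -/

import Mathlib

/-! Maps of finite order in a p-derivation, between sets of points of affine smooth schemes. -/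

namespace DeltaArith

section RestrictedSeries

variable {R : Type*} [CommRing R] {σ : Type*}

/-- A restricted power series: its coefficients tend to `0` `p`-adically, that is, for every `m`
all but finitely many coefficients are divisible by `p ^ m`.  For finite `σ` these are exactly the
elements of the `p`-adic completion of the polynomial ring in the variables `σ` over a
`p`-adically complete ring `R`. -/
def IsRestricted (p : ℕ) (F : MvPowerSeries σ R) : Prop :=
  ∀ m : ℕ, {s : σ →₀ ℕ | ¬ (p : R) ^ m ∣ MvPowerSeries.coeff s F}.Finite

/-- `y` is the value of `F` at the point `a`: the family of the terms of `F` at `a` has sum `y`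
in the `p`-adic topology.  If `R` is `p`-adically complete (and separated) and `F` is restricted,
then there is exactly one such `y`. -/
def EvalsTo (p : ℕ) (F : MvPowerSeries σ R) (a : σ → R) (y : R) : Prop :=
  ∀ m : ℕ, ∃ T : Finset (σ →₀ ℕ), ∀ S : Finset (σ →₀ ℕ), T ⊆ S →
    (p : R) ^ m ∣ y - ∑ s ∈ S, MvPowerSeries.coeff s F * s.prod (fun i e => a i ^ e)

end RestrictedSeries

section DeltaMaps

variable {R : Type*} [CommRing R] {X Y : Type*}

/-- A closed embedding of an affine scheme into affine `N`-space, on `R`-points: an `N`-tuple of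
functions that generates the coordinate ring.  Here `X` is the set of `R`-points, and `OX` is the
coordinate ring, whose elements are viewed as functions on `X`.  For the schemes used below (general
linear groups and affine spaces over an infinite local domain with infinite residue field) an
element of the coordinate ring is determined by its values at the `R`-points. -/
def IsEmbedding (OX : Subalgebra R (X → R)) {N : ℕ} (e : Fin N → X → R) : Prop :=
  Algebra.adjoin R (Set.range e) = OX

/-- `f : X → Y` is a `δ`-map of order `r`: for some embeddings of `X` into `N`-space and of `Y`
into `M`-space, `f` is induced by a map `a ↦ F (a, δ a, ..., δ ^ r a)` from `R ^ N` to `R ^ M`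
that is given by an `M`-tuple `F` of restricted power series in `r + 1` tuples of `N` variables. -/
def IsDeltaMapOfOrder (p : ℕ) (δ : R → R) (r : ℕ)
    (OX : Subalgebra R (X → R)) (OY : Subalgebra R (Y → R)) (f : X → Y) : Prop :=
  ∃ (N M : ℕ) (e : Fin N → X → R) (e' : Fin M → Y → R)
    (F : Fin M → MvPowerSeries (Fin (r + 1) × Fin N) R),
    IsEmbedding OX e ∧ IsEmbedding OY e' ∧ (∀ j, IsRestricted p (F j)) ∧
    ∀ (P : X) (j : Fin M),
      EvalsTo p (F j) (fun ik => δ^[(ik.1 : ℕ)] (e ik.2 P)) (e' j (f P))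

/-- A `δ`-map is a `δ`-map of some finite order. -/
def IsDeltaMap (p : ℕ) (δ : R → R)
    (OX : Subalgebra R (X → R)) (OY : Subalgebra R (Y → R)) (f : X → Y) : Prop :=
  ∃ r : ℕ, IsDeltaMapOfOrder p δ r OX OY f

end DeltaMaps

section Groups

variable (R : Type*) [CommRing R]

/-- The coordinate ring of `GL_n`, generated by the matrix entries and the inverse of the
determinant. -/
def coordGL (n : ℕ) : Subalgebra R (GL (Fin n) R → R) :=
  Algebra.adjoin R
    (Set.range (fun (ij : Fin n × Fin n) (g : GL (Fin n) R) =>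
        (g : Matrix (Fin n) (Fin n) R) ij.1 ij.2) ∪
      {fun g => (((Matrix.GeneralLinearGroup.det g)⁻¹ : Rˣ) : R)})

/-- The coordinate ring of `gl_n`, the affine space of `n × n` matrices. -/
def coordMat (n : ℕ) : Subalgebra R (Matrix (Fin n) (Fin n) R → R) :=
  Algebra.adjoin R
    (Set.range (fun (ij : Fin n × Fin n) (x : Matrix (Fin n) (Fin n) R) => x ij.1 ij.2))

/-- The coordinate ring of the multiplicative group. -/
def coordGm : Subalgebra R (Rˣ → R) :=
  Algebra.adjoin R ({fun u : Rˣ => (u : R), fun u : Rˣ => ((u⁻¹ : Rˣ) : R)} : Set (Rˣ → R))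

/-- The coordinate ring of the additive group. -/
def coordGa : Subalgebra R (R → R) :=
  Algebra.adjoin R ({fun x : R => x} : Set (R → R))

variable {R}

/-- A `δ`-homomorphism from the multiplicative to the additive group. -/
structure IsDeltaHomGmGa (p : ℕ) (δ : R → R) (ω : Rˣ → R) : Prop where
  isDeltaMap : IsDeltaMap p δ (coordGm R) (coordGa R) ω
  map_mul : ∀ a b : Rˣ, ω (a * b) = ω a + ω b

/-- A classical `δ`-cocycle of `GL_n` with values in `gl_n`: a `δ`-map that is a cocycle for the
adjoint action of `GL_n` on its Lie algebra `gl_n` by conjugation. -/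
structure IsClassicalDeltaCocycle (p : ℕ) (δ : R → R) {n : ℕ}
    (f : GL (Fin n) R → Matrix (Fin n) (Fin n) R) : Prop where
  isDeltaMap : IsDeltaMap p δ (coordGL R n) (coordMat R n) f
  cocycle : ∀ g₁ g₂ : GL (Fin n) R,
    f (g₁ * g₂) = f g₁ + (g₁ : Matrix (Fin n) (Fin n) R) * f g₂ *
      ((g₁⁻¹ : GL (Fin n) R) : Matrix (Fin n) (Fin n) R)

end Groups

end DeltaArith

/-!
For the adjoint action of the general linear group on matrices, the classification of cocycles is a
fact about the abstract group `GL_n(R)`: neither continuity nor the form of a `δ`-map is needed,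
because the residue field is perfect and `R` has many roots of unity.

A cocycle `f` is a coboundary on the finite group of diagonal matrices with entries `±1`, by
averaging; after subtraction of this coboundary, `f` is equivariant for these matrices and
(`singleDiag_eq_zero_of_isRootOfUnity`) vanishes on diagonal matrices whose entries are roots of
unity.  Weight considerations then determine `f` on the elementary matrices: `f (1 + a E_ij)` can
only have diagonal entries and entries at `(i, j)` and `(j, i)`.  The entry at `(j, i)` is additive
in `a`, and a root of unity `ζ` acts on it through `ζ⁻¹`.  Since inversion is not additive on the
residue field, it vanishes (`eq_zero_of_inv_equivariant`).  The diagonal entries are then additive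
and even, hence zero, and the entry at `(i, j)` is additive and commutes with roots of unity.
Because every unit is congruent to a root of unity modulo `p`, this entry is `a * c i j` with a
constant `c i j` (`eq_mul_of_equivariant`).

The commutator and braid relations of the elementary matrices say that `c` is additive, that is
`c i j = w j - w i`, so that a further coboundary, of a diagonal matrix, makes `f` vanish on the
elementary matrices (`exists_coboundary_elemUnit`).  These generate a normal subgroup, and together
with the matrices with a single nontrivial diagonal entry they generate `GL_n(R)`, as `R` is local
(`subgroup_eq_top_of_elemUnit_mem`).  So `f` is now scalar and factors through the determinant
(`eq_smul_one_of_elemUnit_eq_zero`).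

The resulting homomorphism is `d ↦ f (diag (d, 1, ..., 1))₁₁`, where subtracting coboundaries has no
effect.  It is a `δ`-map as the composition of `f` with a closed embedding and a coordinate function
(`IsDeltaMap.comp_closedEmbedding`).
-/

namespace DeltaArith

/-! ### Teichmüller units -/

/-- A unit is a root of unity if some power of it equals `1`, where the exponent is required to be
nonzero in the ring, so that an additive invariant of it with values in a domain vanishes. -/
def IsRootOfUnity {R : Type*} [CommRing R] (ζ : Rˣ) : Prop :=
  ∃ m : ℕ, (m : R) ≠ 0 ∧ ζ ^ m = 1

/-- A nonzero element of an algebraic extension of `𝔽_p` is a root of unity of some order `m`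
with `m ≡ -1` modulo `p`. -/
lemma exists_pow_eq_one_of_algebraic (p : ℕ) [Fact p.Prime] {K : Type*} [Field K]
    [Algebra (ZMod p) K] [Algebra.IsAlgebraic (ZMod p) K] {y : K} (hy : y ≠ 0) :
    ∃ m : ℕ, m ≠ 0 ∧ p ∣ m + 1 ∧ y ^ m = 1 := by
  have hint : IsIntegral (ZMod p) y := (Algebra.IsAlgebraic.isAlgebraic y).isIntegral
  let F := IntermediateField.adjoin (ZMod p) {y}
  have : FiniteDimensional (ZMod p) F := IntermediateField.adjoin.finiteDimensional hint
  have : Finite F := Module.finite_of_finite (ZMod p)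
  have := Fintype.ofFinite F
  have : CharP F p := charP_of_injective_algebraMap (algebraMap (ZMod p) F).injective p
  obtain ⟨d, -, hd⟩ := FiniteField.card F p
  have hcard : 1 < Fintype.card F := Fintype.one_lt_card
  have hFq : Fintype.card F = p ^ (d : ℕ) := hd
  let y' : F := ⟨y, IntermediateField.mem_adjoin_simple_self (ZMod p) y⟩
  have hy' : y' ≠ 0 := fun h => hy (congrArg Subtype.val h)
  refine ⟨Fintype.card F - 1, by omega, ?_, ?_⟩
  · rw [Nat.sub_add_cancel hcard.le, hFq]
    exact dvd_pow_self p d.ne_zero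
  · exact congrArg Subtype.val (FiniteField.pow_card_sub_one_eq_one y' hy')

section Teichmuller

variable {p : ℕ} {R : Type*} [CommRing R]

lemma isUnit_of_dvd_sub [IsLocalRing R] (hmax : IsLocalRing.maximalIdeal R = Ideal.span {(p : R)})
    {x y : R} (hx : IsUnit x) (h : (p : R) ∣ x - y) : IsUnit y := by
  by_contra hy
  have hy' : y ∈ IsLocalRing.maximalIdeal R := hy
  have hxy : x - y ∈ IsLocalRing.maximalIdeal R := by
    rw [hmax]; exact Ideal.mem_span_singleton.2 h
  have := add_mem hxy hy'
  rw [sub_add_cancel] at this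
  exact this hx

lemma eq_zero_of_forall_pow_dvd (hcomplete : IsAdicComplete (Ideal.span {(p : R)}) R)
    {x : R} (hx : ∀ m : ℕ, (p : R) ^ m ∣ x) : x = 0 := by
  refine hcomplete.toIsHausdorff.haus x fun m => ?_
  rw [SModEq.zero, Ideal.span_singleton_pow, smul_eq_mul, Ideal.mul_top,
    Ideal.mem_span_singleton]
  exact hx m

lemma additive_mul_pow {g : R → R} (hadd : ∀ a b, g (a + b) = g a + g b) (a : R) :
    g ((p : R) * a) = p * g a := by
  simpa [nsmul_eq_mul] using map_nsmul (AddMonoidHom.mk' g hadd) p a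

variable [Fact p.Prime] [IsLocalRing R]

/-- Every unit is congruent to a root of unity, by Hensel's lemma for `X ^ m - 1`. -/
lemma exists_rootOfUnity_sub_dvd
    (hmax : IsLocalRing.maximalIdeal R = Ideal.span {(p : R)})
    (hcomplete : IsAdicComplete (Ideal.span {(p : R)}) R)
    (hres : Nonempty ((R ⧸ Ideal.span {(p : R)}) ≃+* AlgebraicClosure (ZMod p)))
    {x : R} (hx : IsUnit x) :
    ∃ ζ : Rˣ, IsRootOfUnity ζ ∧ (p : R) ∣ x - ζ := by
  obtain ⟨e⟩ := hres
  let I : Ideal R := Ideal.span {(p : R)}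
  have hy : e (Ideal.Quotient.mk I x) ≠ 0 :=
    (((hx.map (Ideal.Quotient.mk I)).map e).ne_zero)
  obtain ⟨m, hm0, hpm, hym⟩ := exists_pow_eq_one_of_algebraic p hy
  have hxm : Ideal.Quotient.mk I (x ^ m) = 1 := by
    apply e.injective
    rw [map_pow, map_pow, hym, map_one]
  have hmu : IsUnit (m : R) := by
    refine isUnit_of_dvd_sub hmax (x := -1) isUnit_one.neg ?_
    obtain ⟨c, hc⟩ := hpm
    refine ⟨-(c : R), ?_⟩
    have : (m : R) + 1 = p * c := by
      simpa using congrArg (Nat.cast (R := R)) hc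
    linear_combination -this
  obtain ⟨a, ha, hax⟩ := HenselianRing.is_henselian (I := I) (Polynomial.X ^ m - 1)
    (by simpa using Polynomial.monic_X_pow_sub_C (1 : R) hm0) x
    (by
      rw [← Ideal.Quotient.eq_zero_iff_mem]
      simpa [sub_eq_zero] using hxm)
    (by
      have : IsUnit ((m : R) * x ^ (m - 1)) := hmu.mul (hx.pow _)
      rw [Polynomial.derivative_sub, Polynomial.derivative_one, sub_zero,
        Polynomial.derivative_X_pow]
      simpa using this.map (Ideal.Quotient.mk I))
  have ham : a ^ m = 1 := by simpa [sub_eq_zero] using ha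
  refine ⟨Units.ofPowEqOne a m ham hm0, ⟨m, hmu.ne_zero, Units.pow_ofPowEqOne ham hm0⟩, ?_⟩
  have : (p : R) ∣ a - x := Ideal.mem_span_singleton.1 hax
  simpa using (dvd_neg.2 this)

/-- An additive map that is equivariant under multiplication by the roots of unity is linear:
these are representatives of the units modulo `p`, so that the difference to a linear map has
values divisible by all powers of `p`. -/
lemma eq_mul_of_equivariant
    (hmax : IsLocalRing.maximalIdeal R = Ideal.span {(p : R)})
    (hcomplete : IsAdicComplete (Ideal.span {(p : R)}) R)
    (hres : Nonempty ((R ⧸ Ideal.span {(p : R)}) ≃+* AlgebraicClosure (ZMod p)))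
    {g : R → R} (hadd : ∀ a b, g (a + b) = g a + g b)
    (hg : ∀ ζ : Rˣ, IsRootOfUnity ζ → ∀ a, g (ζ * a) = ζ * g a) (a : R) :
    g a = a * g 1 := by
  have key : ∀ m : ℕ, ∀ a, (p : R) ^ m ∣ g a - a * g 1 := by
    intro m
    induction m with
    | zero => simp
    | succ m ih =>
      have hp : ∀ b, (p : R) ^ (m + 1) ∣ g (p * b) - (p * b) * g 1 := fun b => by
        rw [additive_mul_pow hadd, mul_assoc, ← mul_sub, pow_succ']
        exact mul_dvd_mul_left _ (ih b)
      intro a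
      by_cases ha : IsUnit a
      · obtain ⟨ζ, hζ, b, hb⟩ := exists_rootOfUnity_sub_dvd hmax hcomplete hres ha
        have h1 := hg ζ hζ 1
        rw [mul_one] at h1
        rw [sub_eq_iff_eq_add.1 hb, hadd, h1]
        convert hp b using 1
        ring
      · have : a ∈ IsLocalRing.maximalIdeal R := ha
        rw [hmax] at this
        obtain ⟨b, rfl⟩ := Ideal.mem_span_singleton.1 this
        exact hp b
  exact sub_eq_zero.1 (eq_zero_of_forall_pow_dvd hcomplete fun m => key m a)

/-- Inversion is not additive on the residue field: there are roots of unity with `1 + ζ ≡ η`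
modulo `p`, but with `1 + ζ⁻¹` and `η⁻¹` distinct modulo `p`. -/
lemma exists_rootsOfUnity_add_inv
    (hmax : IsLocalRing.maximalIdeal R = Ideal.span {(p : R)})
    (hcomplete : IsAdicComplete (Ideal.span {(p : R)}) R)
    (hres : Nonempty ((R ⧸ Ideal.span {(p : R)}) ≃+* AlgebraicClosure (ZMod p))) :
    ∃ ζ η : Rˣ, IsRootOfUnity ζ ∧ IsRootOfUnity η ∧ (p : R) ∣ 1 + ζ - η ∧
      IsUnit (1 + ((ζ⁻¹ : Rˣ) : R) - ((η⁻¹ : Rˣ) : R)) := by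
  obtain ⟨e⟩ := id hres
  let I : Ideal R := Ideal.span {(p : R)}
  let k := AlgebraicClosure (ZMod p)
  -- `(1 + y)⁻¹ = 1 + y⁻¹` means `y ^ 2 + y + 1 = 0`
  let P : Polynomial k := Polynomial.X * (1 + Polynomial.X) * (1 + Polynomial.X + Polynomial.X ^ 2)
  have hP : P ≠ 0 := by
    have h1 : (1 + Polynomial.X : Polynomial k) ≠ 0 := fun h => by
      simpa using congrArg (Polynomial.eval 0) h
    have h2 : (1 + Polynomial.X + Polynomial.X ^ 2 : Polynomial k) ≠ 0 := fun h => by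
      simpa using congrArg (Polynomial.eval 0) h
    exact mul_ne_zero (mul_ne_zero Polynomial.X_ne_zero h1) h2
  have hinf : Infinite k := IsAlgClosed.instInfinite
  obtain ⟨y, hy⟩ : ∃ y : k, P.eval y ≠ 0 := by
    by_contra! h
    exact hP (Polynomial.funext fun r => by simpa using h r)
  obtain ⟨x, hx⟩ := (e.surjective.comp Ideal.Quotient.mk_surjective) y
  have hx : e (Ideal.Quotient.mk I x) = y := hx
  have hPy : y * (1 + y) * (1 + y + y ^ 2) ≠ 0 := by simpa [P] using hy
  have hu : ∀ z : R, e (Ideal.Quotient.mk I z) ≠ 0 → IsUnit z := fun z hz => by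
    by_contra h
    have : z ∈ IsLocalRing.maximalIdeal R := h
    rw [hmax] at this
    exact hz (by rw [Ideal.Quotient.eq_zero_iff_mem.2 this, map_zero])
  have hu1 : IsUnit x := hu x (by rw [hx]; exact left_ne_zero_of_mul (left_ne_zero_of_mul hPy))
  have hu2 : IsUnit (1 + x) := hu _ (by
    simpa [hx] using right_ne_zero_of_mul (left_ne_zero_of_mul hPy))
  have hu3 : IsUnit (1 + x + x ^ 2) := hu _ (by simpa [hx] using right_ne_zero_of_mul hPy)
  obtain ⟨ζ, hζ, b, hb⟩ := exists_rootOfUnity_sub_dvd hmax hcomplete hres hu1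
  obtain ⟨η, hη, c, hc⟩ := exists_rootOfUnity_sub_dvd hmax hcomplete hres hu2
  refine ⟨ζ, η, hζ, hη, ⟨c - b, by linear_combination hc - hb⟩, ?_⟩
  have h4 : IsUnit ((ζ : R) * η + η - ζ) := by
    refine isUnit_of_dvd_sub hmax hu3 ⟨c * (1 + ζ) + b * x, ?_⟩
    linear_combination (1 + (ζ : R)) * hc + x * hb
  have h5 : (1 + ((ζ⁻¹ : Rˣ) : R) - ((η⁻¹ : Rˣ) : R)) =
      ((ζ⁻¹ * η⁻¹ : Rˣ) : R) * ((ζ : R) * η + η - ζ) := by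
    have h6 := ζ.inv_mul
    have h7 := η.inv_mul
    rw [Units.val_mul]
    linear_combination (-(1 : R) + (η⁻¹ : Rˣ)) * h6
      + (-((ζ⁻¹ : Rˣ) * (ζ : R)) - (ζ⁻¹ : Rˣ)) * h7
  rw [h5]
  exact (ζ⁻¹ * η⁻¹).isUnit.mul h4

/-- An additive map on which the roots of unity act through inversion vanishes. -/
lemma eq_zero_of_inv_equivariant
    (hmax : IsLocalRing.maximalIdeal R = Ideal.span {(p : R)})
    (hcomplete : IsAdicComplete (Ideal.span {(p : R)}) R)
    (hres : Nonempty ((R ⧸ Ideal.span {(p : R)}) ≃+* AlgebraicClosure (ZMod p)))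
    {z : R → R} (hadd : ∀ a b, z (a + b) = z a + z b)
    (hz : ∀ ζ : Rˣ, IsRootOfUnity ζ → ∀ a, z (ζ * a) = ((ζ⁻¹ : Rˣ) : R) * z a) (a : R) :
    z a = 0 := by
  obtain ⟨ζ, η, hζ, hη, ⟨b, hb⟩, hu⟩ := exists_rootsOfUnity_add_inv hmax hcomplete hres
  have key : ∀ a, (1 + ((ζ⁻¹ : Rˣ) : R) - ((η⁻¹ : Rˣ) : R)) * z a = p * z (b * a) := fun a => by
    have h1 : a + ζ * a = η * a + p * (b * a) := by linear_combination a * hb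
    have h2 := congrArg z h1
    rw [hadd, hadd, hz ζ hζ, hz η hη, additive_mul_pow hadd] at h2
    linear_combination h2
  refine eq_zero_of_forall_pow_dvd hcomplete fun m => ?_
  induction m generalizing a with
  | zero => simp
  | succ m ih =>
    rw [← hu.dvd_mul_left, key, pow_succ']
    exact mul_dvd_mul_left _ (ih _)

end Teichmuller

/-! ### Generators of the general linear group of a local ring -/

open Matrix

section Generators

variable {R : Type*} [CommRing R] {n : ℕ}

/-- The elementary matrix `1 + a E_ij` as an element of the general linear group. -/
def elemUnit {i j : Fin n} (hij : i ≠ j) (a : R) : GL (Fin n) R where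
  val := transvection i j a
  inv := transvection i j (-a)
  val_inv := by rw [transvection_mul_transvection_same i j hij, add_neg_cancel, transvection_zero]
  inv_val := by rw [transvection_mul_transvection_same i j hij, neg_add_cancel, transvection_zero]

lemma coe_elemUnit {i j : Fin n} (hij : i ≠ j) (a : R) :
    (elemUnit hij a : Matrix (Fin n) (Fin n) R) = transvection i j a := rfl

lemma coe_elemUnit_inv {i j : Fin n} (hij : i ≠ j) (a : R) :
    (((elemUnit hij a)⁻¹ : GL (Fin n) R) : Matrix (Fin n) (Fin n) R) = transvection i j (-a) := rfl

/-- The invertible diagonal matrix with given entries. -/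
def diagUnit (t : Fin n → Rˣ) : GL (Fin n) R where
  val := diagonal fun i => (t i : R)
  inv := diagonal fun i => (((t i)⁻¹ : Rˣ) : R)
  val_inv := by simp
  inv_val := by simp

lemma coe_diagUnit (t : Fin n → Rˣ) :
    (diagUnit t : Matrix (Fin n) (Fin n) R) = diagonal fun i => (t i : R) := rfl

lemma coe_diagUnit_inv (t : Fin n → Rˣ) :
    (((diagUnit t)⁻¹ : GL (Fin n) R) : Matrix (Fin n) (Fin n) R) =
      diagonal fun i => (((t i)⁻¹ : Rˣ) : R) := rfl

lemma diagUnit_mul (s t : Fin n → Rˣ) : diagUnit (s * t) = diagUnit s * diagUnit t := by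
  refine Units.ext ?_
  rw [GeneralLinearGroup.coe_mul, coe_diagUnit, coe_diagUnit, coe_diagUnit, diagonal_mul_diagonal]
  simp

lemma diagUnit_one : diagUnit (1 : Fin n → Rˣ) = 1 := by
  refine GeneralLinearGroup.ext fun i j => ?_
  simp [coe_diagUnit]

lemma diagUnit_pow (t : Fin n → Rˣ) (m : ℕ) : diagUnit (t ^ m) = diagUnit t ^ m := by
  induction m with
  | zero => simp [diagUnit_one]
  | succ m ih => rw [pow_succ, diagUnit_mul, ih, pow_succ]

/-- The diagonal matrix with entry `d` at `i` and `1` elsewhere. -/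
def singleDiag (i : Fin n) (d : Rˣ) : GL (Fin n) R := diagUnit (Function.update 1 i d)

lemma singleDiag_one (i : Fin n) : singleDiag i (1 : Rˣ) = 1 := by
  rw [singleDiag, Function.update_one, diagUnit_one]

lemma singleDiag_mul (i : Fin n) (a b : Rˣ) :
    singleDiag i (a * b) = singleDiag i a * singleDiag i b := by
  rw [singleDiag, singleDiag, singleDiag, ← diagUnit_mul, ← Function.update_mul, one_mul]

lemma det_singleDiag (i : Fin n) (d : Rˣ) :
    Matrix.GeneralLinearGroup.det (singleDiag i d) = d := by
  ext
  simp only [Matrix.GeneralLinearGroup.val_det_apply, singleDiag, coe_diagUnit, det_diagonal]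
  rw [← Units.coe_prod, Finset.prod_update_of_mem (Finset.mem_univ i)]
  simp

lemma det_elemUnit {i j : Fin n} (hij : i ≠ j) (a : R) :
    Matrix.GeneralLinearGroup.det (elemUnit hij a) = 1 := by
  ext
  simp [coe_elemUnit, hij]

/-- The first `k` columns of the matrix are those of the identity. -/
def FirstColumnsStd (k : ℕ) (g : GL (Fin n) R) : Prop :=
  ∀ i j : Fin n, (j : ℕ) < k → (g : Matrix (Fin n) (Fin n) R) i j = (1 : Matrix _ _ R) i j

lemma FirstColumnsStd.elemUnit_mul {k : ℕ} {g : GL (Fin n) R} (hg : FirstColumnsStd k g)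
    {i j : Fin n} (hij : i ≠ j) (hj : k ≤ j) (a : R) :
    FirstColumnsStd k (elemUnit hij a * g) := by
  intro r c hc
  rw [GeneralLinearGroup.coe_mul, coe_elemUnit]
  by_cases hr : r = i
  · subst hr
    rw [transvection_mul_apply_same, hg _ _ hc, hg _ _ hc, one_apply_ne (i := j), mul_zero,
      add_zero]
    rintro rfl
    omega
  · rw [transvection_mul_apply_of_ne _ _ _ _ hr, hg _ _ hc]

lemma FirstColumnsStd.singleDiag_mul {k : ℕ} {g : GL (Fin n) R} (hg : FirstColumnsStd k g)
    {i : Fin n} (hi : k ≤ i) (d : Rˣ) : FirstColumnsStd k (singleDiag i d * g) := by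
  intro r c hc
  rw [GeneralLinearGroup.coe_mul, singleDiag, coe_diagUnit, diagonal_mul, hg _ _ hc]
  by_cases hr : r = i
  · subst hr
    rw [one_apply_ne, mul_zero]
    rintro rfl
    omega
  · simp [hr]

/-- The part of a column on and below the diagonal has an invertible entry: multiplication by the
inverse matrix expresses `1` as a combination of these entries. -/
lemma FirstColumnsStd.exists_isUnit [IsLocalRing R] {k : Fin n} {g : GL (Fin n) R}
    (hg : FirstColumnsStd k g) :
    ∃ i : Fin n, k ≤ i ∧ IsUnit ((g : Matrix (Fin n) (Fin n) R) i k) := by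
  by_contra! h
  have h1 : ((g⁻¹ : GL (Fin n) R) * g : Matrix (Fin n) (Fin n) R) = 1 := by
    rw [← GeneralLinearGroup.coe_mul, inv_mul_cancel, GeneralLinearGroup.coe_one]
  have h2 : ∀ i < k, ((g⁻¹ : GL (Fin n) R) : Matrix (Fin n) (Fin n) R) k i = 0 := by
    intro i hi
    have h3 := congrFun (congrFun h1 k) i
    rw [mul_apply, one_apply_ne hi.ne', Finset.sum_eq_single i] at h3
    · rwa [hg i i hi, one_apply_eq, mul_one] at h3
    · intro b _ hb
      rw [hg b i hi, one_apply_ne hb, mul_zero]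
    · simp
  have h4 := congrFun (congrFun h1 k) k
  rw [mul_apply, one_apply_eq] at h4
  have h5 : (1 : R) ∈ IsLocalRing.maximalIdeal R := by
    rw [← h4]
    refine sum_mem fun i _ => ?_
    rcases lt_or_ge i k with hi | hi
    · rw [h2 i hi, zero_mul]
      exact zero_mem _
    · exact Ideal.mul_mem_left _ _ (h i hi)
  exact h5 isUnit_one

/-- A step of column elimination. -/
lemma FirstColumnsStd.exists_succ [IsLocalRing R] {H : Subgroup (GL (Fin n) R)}
    (hE : ∀ (i j : Fin n) (hij : i ≠ j) (a : R), elemUnit hij a ∈ H)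
    (hD : ∀ (i : Fin n) (d : Rˣ), singleDiag i d ∈ H)
    {k : Fin n} {g : GL (Fin n) R} (hg : FirstColumnsStd k g) :
    ∃ h ∈ H, FirstColumnsStd (k + 1) (h * g) := by
  obtain ⟨h₁, h₁H, hg₁, hu⟩ : ∃ h ∈ H, FirstColumnsStd k (h * g) ∧
      IsUnit (((h * g : GL (Fin n) R) : Matrix (Fin n) (Fin n) R) k k) := by
    by_cases hk : IsUnit ((g : Matrix (Fin n) (Fin n) R) k k)
    · exact ⟨1, H.one_mem, by rwa [one_mul], by rwa [one_mul]⟩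
    · obtain ⟨i, hki, d, hd⟩ := hg.exists_isUnit
      have hne : k ≠ i := by
        rintro rfl
        exact hk ⟨d, hd⟩
      refine ⟨elemUnit hne (((d⁻¹ : Rˣ) : R) * (1 - (g : Matrix (Fin n) (Fin n) R) k k)),
        hE _ _ _ _, hg.elemUnit_mul hne hki _, ?_⟩
      rw [GeneralLinearGroup.coe_mul, coe_elemUnit, transvection_mul_apply_same, ← hd,
        mul_right_comm, Units.inv_mul]
      simp
  obtain ⟨d, hd⟩ := hu
  obtain ⟨h₂, h₂H, hg₂, hkk⟩ : ∃ h ∈ H, FirstColumnsStd k (h * g) ∧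
      ((h * g : GL (Fin n) R) : Matrix (Fin n) (Fin n) R) k k = 1 := by
    refine ⟨singleDiag k d⁻¹ * h₁, H.mul_mem (hD _ _) h₁H, ?_, ?_⟩
    · rw [mul_assoc]
      exact hg₁.singleDiag_mul le_rfl _
    · rw [mul_assoc, GeneralLinearGroup.coe_mul, singleDiag, coe_diagUnit, diagonal_mul, ← hd]
      simp
  have key : ∀ S : Finset (Fin n), ∃ h ∈ H, FirstColumnsStd k (h * g) ∧
      ((h * g : GL (Fin n) R) : Matrix (Fin n) (Fin n) R) k k = 1 ∧
      ∀ i ∈ S, i ≠ k → ((h * g : GL (Fin n) R) : Matrix (Fin n) (Fin n) R) i k = 0 := by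
    intro S
    induction S using Finset.induction_on with
    | empty => exact ⟨h₂, h₂H, hg₂, hkk, by simp⟩
    | insert r S hr ih =>
      obtain ⟨h, hH, hstd, hone, hzero⟩ := ih
      by_cases hrk : r = k
      · refine ⟨h, hH, hstd, hone, fun i hi hik => hzero i ?_ hik⟩
        exact (Finset.mem_insert.1 hi).resolve_left fun e => hik (e.trans hrk)
      · refine ⟨elemUnit hrk (-((h * g : GL (Fin n) R) : Matrix (Fin n) (Fin n) R) r k) * h,
          H.mul_mem (hE _ _ _ _) hH, ?_, ?_, ?_⟩
        · rw [mul_assoc]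
          exact hstd.elemUnit_mul hrk le_rfl _
        · rw [mul_assoc, GeneralLinearGroup.coe_mul, coe_elemUnit,
            transvection_mul_apply_of_ne _ _ _ _ (Ne.symm hrk), hone]
        · intro i hi hik
          rw [mul_assoc, GeneralLinearGroup.coe_mul, coe_elemUnit]
          by_cases hir : i = r
          · subst hir
            rw [transvection_mul_apply_same, hone]
            simp
          · rw [transvection_mul_apply_of_ne _ _ _ _ hir]
            exact hzero i ((Finset.mem_insert.1 hi).resolve_left hir) hik
  obtain ⟨h, hH, hstd, hone, hzero⟩ := key Finset.univ
  refine ⟨h, hH, fun i j hj => ?_⟩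
  rcases Nat.lt_succ_iff_lt_or_eq.1 hj with hj | hj
  · exact hstd i j hj
  · obtain rfl : j = k := Fin.ext hj
    by_cases hij : i = j
    · rw [hij, hone, one_apply_eq]
    · rw [hzero i (Finset.mem_univ i) hij, one_apply_ne hij]

/-- The general linear group of a local ring is generated by the elementary matrices and the
diagonal matrices with at most one entry different from `1`. -/
lemma subgroup_eq_top_of_elemUnit_mem [IsLocalRing R] {H : Subgroup (GL (Fin n) R)}
    (hE : ∀ (i j : Fin n) (hij : i ≠ j) (a : R), elemUnit hij a ∈ H)
    (hD : ∀ (i : Fin n) (d : Rˣ), singleDiag i d ∈ H) : H = ⊤ := by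
  have key : ∀ m k : ℕ, k + m = n → ∀ g : GL (Fin n) R, FirstColumnsStd k g → g ∈ H := by
    intro m
    induction m with
    | zero =>
      intro k hk g hg
      have : g = 1 := by
        refine GeneralLinearGroup.ext fun i j => ?_
        exact hg i j (by omega)
      rw [this]
      exact H.one_mem
    | succ m ih =>
      intro k hk g hg
      obtain ⟨h, hH, hg'⟩ := FirstColumnsStd.exists_succ hE hD (k := ⟨k, by omega⟩) hg
      exact (H.mul_mem_cancel_left hH).1 (ih (k + 1) (by omega) _ hg')
  exact (Subgroup.eq_top_iff' H).2 fun g => key n 0 (zero_add n) g fun _ _ h => by omega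

end Generators

/-! ### Cocycles of the adjoint action -/

/-- A cocycle of the general linear group for its action on matrices by conjugation. -/
def IsAdjointCocycle {R : Type*} [CommRing R] {n : ℕ}
    (f : GL (Fin n) R → Matrix (Fin n) (Fin n) R) : Prop :=
  ∀ g₁ g₂ : GL (Fin n) R,
    f (g₁ * g₂) = f g₁ + (g₁ : Matrix (Fin n) (Fin n) R) * f g₂ *
      ((g₁⁻¹ : GL (Fin n) R) : Matrix (Fin n) (Fin n) R)

lemma eq_zero_of_neg_eq {R : Type*} [CommRing R] (h2 : IsUnit (2 : R)) {x : R} (hx : -x = x) :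
    x = 0 := by
  rw [← h2.mul_right_eq_zero]
  linear_combination -hx

lemma conj_diagUnit_apply {R : Type*} [CommRing R] {n : ℕ} (t : Fin n → Rˣ)
    (X : Matrix (Fin n) (Fin n) R) (k l : Fin n) :
    ((diagUnit t : Matrix (Fin n) (Fin n) R) * X *
      (((diagUnit t)⁻¹ : GL (Fin n) R) : Matrix (Fin n) (Fin n) R)) k l =
      t k * X k l * (((t l)⁻¹ : Rˣ) : R) := by
  rw [coe_diagUnit, coe_diagUnit_inv, mul_diagonal, diagonal_mul]

lemma diagUnit_mul_elemUnit_mul_inv {R : Type*} [CommRing R] {n : ℕ} {i j : Fin n}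
    (hij : i ≠ j) (t : Fin n → Rˣ) (a : R) :
    diagUnit t * elemUnit hij a * (diagUnit t)⁻¹ =
      elemUnit hij (t i * a * (((t j)⁻¹ : Rˣ) : R)) := by
  refine GeneralLinearGroup.ext fun k l => ?_
  rw [GeneralLinearGroup.coe_mul, GeneralLinearGroup.coe_mul, conj_diagUnit_apply,
    coe_elemUnit, coe_elemUnit, transvection, transvection, Matrix.add_apply, Matrix.add_apply]
  by_cases h : i = k ∧ j = l
  · obtain ⟨rfl, rfl⟩ := h
    simp [hij]
  · rw [single_apply_of_ne _ _ _ _ _ h, single_apply_of_ne _ _ _ _ _ h]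
    by_cases hkl : k = l
    · subst hkl
      simp
    · simp [one_apply_ne hkl]

lemma singleDiag_mul_elemUnit_mul_inv_left {R : Type*} [CommRing R] {n : ℕ} {i j : Fin n}
    (hij : i ≠ j) (ζ : Rˣ) (a : R) :
    singleDiag i ζ * elemUnit hij a * (singleDiag i ζ)⁻¹ = elemUnit hij (ζ * a) := by
  rw [singleDiag, diagUnit_mul_elemUnit_mul_inv]
  simp [hij.symm]

lemma singleDiag_mul_elemUnit_mul_inv_of_ne {R : Type*} [CommRing R] {n : ℕ} {i j : Fin n}
    (hij : i ≠ j) {r : Fin n} (hi : i ≠ r) (hj : j ≠ r) (ζ : Rˣ) (a : R) :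
    singleDiag r ζ * elemUnit hij a * (singleDiag r ζ)⁻¹ = elemUnit hij a := by
  rw [singleDiag, diagUnit_mul_elemUnit_mul_inv]
  simp [hi, hj]

namespace IsAdjointCocycle

variable {R : Type*} [CommRing R] {n : ℕ} {f : GL (Fin n) R → Matrix (Fin n) (Fin n) R}

lemma map_one (hf : IsAdjointCocycle f) : f 1 = 0 := by
  simpa using hf 1 1

lemma map_inv (hf : IsAdjointCocycle f) (g : GL (Fin n) R) :
    f g⁻¹ = -((g⁻¹ : GL (Fin n) R) * f g * g : Matrix (Fin n) (Fin n) R) := by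
  have h := hf g⁻¹ g
  rw [inv_mul_cancel, hf.map_one, inv_inv] at h
  exact eq_neg_of_add_eq_zero_left h.symm

/-- The map `g ↦ f g * g` is a derivation. -/
lemma map_mul_mul (hf : IsAdjointCocycle f) (g h : GL (Fin n) R) :
    f (g * h) * ((g * h : GL (Fin n) R) : Matrix (Fin n) (Fin n) R) =
      f g * g * h + g * (f h * h) := by
  rw [hf, GeneralLinearGroup.coe_mul, add_mul, mul_assoc (f g)]
  congr 1
  rw [mul_assoc, Units.inv_mul_cancel_left, mul_assoc]

lemma sub_coboundary (hf : IsAdjointCocycle f) (v : Matrix (Fin n) (Fin n) R) :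
    IsAdjointCocycle fun g => f g - ((g : Matrix (Fin n) (Fin n) R) * v *
      ((g⁻¹ : GL (Fin n) R) : Matrix (Fin n) (Fin n) R) - v) := by
  intro g h
  simp only [hf g h, GeneralLinearGroup.coe_mul, _root_.mul_inv_rev]
  noncomm_ring

lemma map_conj (hf : IsAdjointCocycle f) {s : GL (Fin n) R} (hs : f s = 0) (u : GL (Fin n) R) :
    f (s * u * s⁻¹) = s * f u * ((s⁻¹ : GL (Fin n) R) : Matrix (Fin n) (Fin n) R) := by
  rw [hf, hf, hf.map_inv, hs]
  simp

/-- A cocycle is a coboundary on the image of a finite group of invertible order. -/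
lemma exists_coboundary_of_finite (hf : IsAdjointCocycle f) {G : Type*} [Group G] [Fintype G]
    (hG : IsUnit (Fintype.card G : R)) (ρ : G →* GL (Fin n) R) :
    ∃ v : Matrix (Fin n) (Fin n) R, ∀ s : G, f (ρ s) = (ρ s : Matrix (Fin n) (Fin n) R) * v *
      (((ρ s)⁻¹ : GL (Fin n) R) : Matrix (Fin n) (Fin n) R) - v := by
  obtain ⟨d, hd⟩ := hG
  let A := ∑ s : G, f (ρ s)
  refine ⟨-(((d⁻¹ : Rˣ) : R) • A), fun s => ?_⟩
  have h1 : A = (d : R) • f (ρ s) + (ρ s : Matrix (Fin n) (Fin n) R) * A *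
      (((ρ s)⁻¹ : GL (Fin n) R) : Matrix (Fin n) (Fin n) R) := by
    calc A = ∑ x : G, f (ρ (s * x)) :=
          (Fintype.sum_equiv (Equiv.mulLeft s) _ _ fun x => rfl).symm
      _ = _ := by
        simp only [_root_.map_mul, hf (ρ s), Finset.sum_add_distrib, A, Finset.mul_sum,
          Finset.sum_mul]
        rw [Finset.sum_const, Finset.card_univ, hd, Nat.cast_smul_eq_nsmul]
  have h2 := congrArg (fun X => ((d⁻¹ : Rˣ) : R) • X) h1
  simp only [smul_add, smul_smul, Units.inv_mul, one_smul] at h2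
  rw [eq_sub_of_add_eq h2.symm]
  simp only [mul_neg, neg_mul, Matrix.mul_smul, Matrix.smul_mul]
  abel

/-- After subtraction of a coboundary, a cocycle vanishes on the diagonal matrices with entries
`±1`. -/
lemma exists_coboundary_singleDiag_neg_one (hf : IsAdjointCocycle f) (h2 : IsUnit (2 : R)) :
    ∃ v : Matrix (Fin n) (Fin n) R, ∀ k : Fin n, f (singleDiag k (-1)) =
      ((singleDiag k (-1) : GL (Fin n) R) : Matrix (Fin n) (Fin n) R) * v *
      (((singleDiag k (-1))⁻¹ : GL (Fin n) R) : Matrix (Fin n) (Fin n) R) - v := by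
  let ρ : (Fin n → ℤˣ) →* GL (Fin n) R :=
    { toFun := fun s => diagUnit fun i => Units.map (Int.castRingHom R).toMonoidHom (s i)
      map_one' := by
        rw [← diagUnit_one]
        congr 1
        ext i
        simp
      map_mul' := fun s t => by
        rw [← diagUnit_mul]
        congr 1
        ext i
        simp }
  obtain ⟨v, hv⟩ := hf.exists_coboundary_of_finite (by simpa using h2.pow n) ρ
  refine ⟨v, fun k => ?_⟩
  have hρ : ρ (Function.update 1 k (-1)) = singleDiag k (-1) := by
    change diagUnit _ = diagUnit _
    congr 1
    ext i
    by_cases hik : i = k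
    · subst hik
      simp
    · simp [hik]
  rw [← hρ]
  exact hv _

section SignNormalized

variable (hs : ∀ k : Fin n, f (singleDiag k (-1)) = 0) (h2 : IsUnit (2 : R))

include hs h2

/-- A matrix that is fixed by the diagonal sign matrix at `k` has no off-diagonal entries in row
and column `k`. -/
lemma apply_eq_zero_of_conj_eq (hf : IsAdjointCocycle f) {u : GL (Fin n) R} {k l r : Fin n}
    (hkl : k ≠ l) (hr : r = k ∨ r = l)
    (hu : singleDiag r (-1) * u * (singleDiag r (-1))⁻¹ = u) : f u k l = 0 := by
  have h := hf.map_conj (hs r) u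
  rw [hu] at h
  have h' := congrFun (congrFun h k) l
  rw [singleDiag, conj_diagUnit_apply] at h'
  refine eq_zero_of_neg_eq h2 ?_
  rcases hr with rfl | rfl
  · simpa [hkl.symm] using h'.symm
  · simpa [hkl] using h'.symm

lemma diagUnit_apply_eq_zero (hf : IsAdjointCocycle f) (t : Fin n → Rˣ) {k l : Fin n}
    (hkl : k ≠ l) : f (diagUnit t) k l = 0 := by
  refine apply_eq_zero_of_conj_eq hs h2 hf hkl (Or.inl rfl) ?_
  rw [singleDiag, ← diagUnit_mul, mul_comm, diagUnit_mul, mul_inv_cancel_right]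

lemma diagUnit_conj (hf : IsAdjointCocycle f) (s t : Fin n → Rˣ) :
    (diagUnit s : Matrix (Fin n) (Fin n) R) * f (diagUnit t) *
      (((diagUnit s)⁻¹ : GL (Fin n) R) : Matrix (Fin n) (Fin n) R) = f (diagUnit t) := by
  ext k l
  rw [conj_diagUnit_apply]
  by_cases hkl : k = l
  · subst hkl
    rw [mul_right_comm, Units.mul_inv, one_mul]
  · rw [diagUnit_apply_eq_zero hs h2 hf t hkl, mul_zero, zero_mul]

lemma singleDiag_eq_zero_of_isRootOfUnity [IsDomain R] (hf : IsAdjointCocycle f) (k : Fin n)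
    {ζ : Rˣ} (hζ : IsRootOfUnity ζ) : f (singleDiag k ζ) = 0 := by
  obtain ⟨m, hm, hζm⟩ := hζ
  have hpow : ∀ r : ℕ, f (singleDiag k ζ ^ r) = (r : R) • f (singleDiag k ζ) := by
    intro r
    induction r with
    | zero => simp [hf.map_one]
    | succ r ih =>
      rw [pow_succ', hf, ih, Matrix.mul_smul, Matrix.smul_mul]
      unfold singleDiag
      rw [diagUnit_conj hs h2 hf]
      push_cast
      rw [add_smul, one_smul, add_comm]
  have h1 : singleDiag k ζ ^ m = 1 := by
    rw [singleDiag, ← diagUnit_pow, ← diagUnit_one]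
    congr 1
    ext i
    by_cases hik : i = k
    · subst hik
      simp [hζm]
    · simp [hik]
  have h3 := hpow m
  rw [h1, hf.map_one] at h3
  exact (smul_eq_zero.1 h3.symm).resolve_left hm

end SignNormalized

end IsAdjointCocycle

/-! ### Values on elementary matrices -/

namespace IsAdjointCocycle

variable {R : Type*} [CommRing R] {n : ℕ} {f : GL (Fin n) R → Matrix (Fin n) (Fin n) R}

lemma map_elemUnit_add (hf : IsAdjointCocycle f) {i j : Fin n} (hij : i ≠ j) (a b : R) :
    f (elemUnit hij (a + b)) = f (elemUnit hij a) +
      transvection i j a * f (elemUnit hij b) * transvection i j (-a) := by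
  have h : elemUnit hij (a + b) = elemUnit hij a * elemUnit hij b :=
    Units.ext (transvection_mul_transvection_same i j hij a b).symm
  rw [h, hf]
  rfl

lemma map_elemUnit_lower_add (hf : IsAdjointCocycle f) {i j : Fin n} (hij : i ≠ j) (a b : R) :
    f (elemUnit hij (a + b)) j i = f (elemUnit hij a) j i + f (elemUnit hij b) j i := by
  rw [hf.map_elemUnit_add, Matrix.add_apply, mul_transvection_apply_of_ne _ _ _ _ hij,
    transvection_mul_apply_of_ne _ _ _ _ hij.symm]

lemma map_elemUnit_diag_add (hf : IsAdjointCocycle f) {i j : Fin n} (hij : i ≠ j)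
    (hz : ∀ a, f (elemUnit hij a) j i = 0) (k : Fin n) (a b : R) :
    f (elemUnit hij (a + b)) k k = f (elemUnit hij a) k k + f (elemUnit hij b) k k := by
  rw [hf.map_elemUnit_add, Matrix.add_apply]
  congr 1
  by_cases hj : k = j
  · subst hj
    rw [mul_transvection_apply_same, transvection_mul_apply_of_ne _ _ _ _ hij.symm,
      transvection_mul_apply_of_ne _ _ _ _ hij.symm, hz, mul_zero, add_zero]
  · rw [mul_transvection_apply_of_ne _ _ _ _ hj]
    by_cases hi : k = i
    · subst hi
      rw [transvection_mul_apply_same, hz, mul_zero, add_zero]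
    · rw [transvection_mul_apply_of_ne _ _ _ _ hi]

lemma map_elemUnit_upper_add (hf : IsAdjointCocycle f) {i j : Fin n} (hij : i ≠ j)
    (hz : ∀ a, f (elemUnit hij a) j i = 0) (hd : ∀ k a, f (elemUnit hij a) k k = 0) (a b : R) :
    f (elemUnit hij (a + b)) i j = f (elemUnit hij a) i j + f (elemUnit hij b) i j := by
  rw [hf.map_elemUnit_add, Matrix.add_apply, mul_transvection_apply_same,
    transvection_mul_apply_same, transvection_mul_apply_same, hz, hd, hd]
  simp

/-- A cocycle that vanishes on the diagonal sign matrices is linear on each elementary subgroup: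
the entry at `(j, i)` is additive and of the wrong weight, the entries on the diagonal are then
additive and even, and the entry at `(i, j)` is then additive and equivariant. -/
lemma map_elemUnit_eq_single {p : ℕ} [Fact p.Prime] [IsDomain R] [IsLocalRing R]
    (hmax : IsLocalRing.maximalIdeal R = Ideal.span {(p : R)})
    (hcomplete : IsAdicComplete (Ideal.span {(p : R)}) R)
    (hres : Nonempty ((R ⧸ Ideal.span {(p : R)}) ≃+* AlgebraicClosure (ZMod p)))
    (h2 : IsUnit (2 : R)) (hf : IsAdjointCocycle f)
    (hs : ∀ k : Fin n, f (singleDiag k (-1)) = 0) {i j : Fin n} (hij : i ≠ j) (a : R) :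
    f (elemUnit hij a) = single i j (a * f (elemUnit hij 1) i j) := by
  have htorus : ∀ ζ : Rˣ, IsRootOfUnity ζ → ∀ a k l, f (elemUnit hij (ζ * a)) k l =
      (Function.update (1 : Fin n → Rˣ) i ζ k : Rˣ) * f (elemUnit hij a) k l *
        (((Function.update (1 : Fin n → Rˣ) i ζ l)⁻¹ : Rˣ) : R) := fun ζ hζ a k l => by
    rw [← singleDiag_mul_elemUnit_mul_inv_left,
      hf.map_conj (singleDiag_eq_zero_of_isRootOfUnity hs h2 hf i hζ), singleDiag,
      conj_diagUnit_apply]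
  have hz : ∀ a, f (elemUnit hij a) j i = 0 :=
    eq_zero_of_inv_equivariant hmax hcomplete hres (hf.map_elemUnit_lower_add hij)
      fun ζ hζ a => by
        rw [htorus ζ hζ]
        simp [hij.symm, mul_comm]
  have hd : ∀ k a, f (elemUnit hij a) k k = 0 := fun k a => by
    have hadd := hf.map_elemUnit_diag_add hij hz k
    have h0 : f (elemUnit hij 0) k k = 0 := by simpa using hadd 0 0
    have hneg := hadd a (-a)
    have hm1 : IsRootOfUnity (-1 : Rˣ) := ⟨2, by simpa using h2.ne_zero, by simp⟩
    have heven : f (elemUnit hij (-a)) k k = f (elemUnit hij a) k k := by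
      have := htorus (-1) hm1 a k k
      rw [mul_right_comm, Units.mul_inv, one_mul] at this
      simpa using this
    rw [add_neg_cancel, h0, heven] at hneg
    exact eq_zero_of_neg_eq h2 (by linear_combination hneg)
  have hy := eq_mul_of_equivariant hmax hcomplete hres
    (g := fun a => f (elemUnit hij a) i j) (hf.map_elemUnit_upper_add hij hz hd)
    fun ζ hζ a => by
      simp [htorus ζ hζ, hij.symm]
  ext k l
  by_cases h : i = k ∧ j = l
  · obtain ⟨rfl, rfl⟩ := h
    rw [single_apply_same]
    exact hy a
  rw [single_apply_of_ne _ _ _ _ _ h]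
  by_cases hkl : k = l
  · rw [hkl, hd]
  by_cases h' : k = j ∧ l = i
  · rw [h'.1, h'.2, hz]
  -- one of `k` and `l` differs from both `i` and `j`
  by_cases hk : k = i ∨ k = j
  · refine apply_eq_zero_of_conj_eq hs h2 hf hkl (Or.inr rfl)
      (singleDiag_mul_elemUnit_mul_inv_of_ne hij ?_ ?_ _ _) <;> grind
  · refine apply_eq_zero_of_conj_eq hs h2 hf hkl (Or.inl rfl)
      (singleDiag_mul_elemUnit_mul_inv_of_ne hij ?_ ?_ _ _) <;> grind

section Relations

variable {c : Fin n → Fin n → R}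
  (hc : ∀ (i j : Fin n) (hij : i ≠ j) (a : R), f (elemUnit hij a) = single i j (a * c i j))

include hc

lemma map_elemUnit_mul_self {i j : Fin n} (hij : i ≠ j) (a : R) :
    f (elemUnit hij a) * (elemUnit hij a : GL (Fin n) R) = single i j (a * c i j) := by
  rw [hc, coe_elemUnit, transvection, mul_add, mul_one, single_mul_single_of_ne _ _ _ _ hij.symm,
    add_zero]

/-- The commutator relation of the elementary matrices at `(i, j)` and `(j, k)`. -/
lemma coeff_add (hf : IsAdjointCocycle f) {i j k : Fin n} (hij : i ≠ j) (hjk : j ≠ k)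
    (hik : i ≠ k) : c i j + c j k = c i k := by
  have hrel : elemUnit hij (1 : R) * elemUnit hjk 1 =
      elemUnit hik 1 * (elemUnit hjk 1 * elemUnit hij 1) := by
    refine Units.ext ?_
    simp only [GeneralLinearGroup.coe_mul, coe_elemUnit, transvection, mul_add, add_mul, one_mul,
      mul_one, single_mul_single_same, single_mul_single_of_ne _ _ _ _ hik.symm,
      single_mul_single_of_ne _ _ _ _ hjk.symm]
    simp only [mul_zero, add_zero]
    abel
  have h := congrArg (fun g : GL (Fin n) R => (f g * (g : Matrix (Fin n) (Fin n) R)) i k) hrel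
  simp only [hf.map_mul_mul, map_elemUnit_mul_self hc] at h
  simpa [coe_elemUnit, transvection, mul_add, add_mul, hik.symm, hjk.symm, hij.symm, hij, hik, hjk]
    using h

/-- The braid relation `u v u = v u v` for `u = 1 + E_ij` and `v = 1 - E_ji`. -/
lemma coeff_add_swap (hf : IsAdjointCocycle f) {i j : Fin n} (hij : i ≠ j) :
    c i j + c j i = 0 := by
  have hrel : elemUnit hij (1 : R) * (elemUnit hij.symm (-1) * elemUnit hij 1) =
      elemUnit hij.symm (-1) * (elemUnit hij 1 * elemUnit hij.symm (-1)) := by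
    refine Units.ext ?_
    simp only [GeneralLinearGroup.coe_mul, coe_elemUnit, transvection, mul_add, add_mul, one_mul,
      mul_one, single_mul_single_same]
    simp [hij, hij.symm, ← single_neg]
    abel
  have h := congrArg (fun g : GL (Fin n) R => (f g * (g : Matrix (Fin n) (Fin n) R)) i j) hrel
  simp only [hf.map_mul_mul, map_elemUnit_mul_self hc] at h
  simp [coe_elemUnit, transvection, mul_add, add_mul, hij.symm, hij] at h
  linear_combination -h

end Relations

end IsAdjointCocycle

/-! ### Classification of the cocycles of the adjoint action -/

namespace IsAdjointCocycle

variable {R : Type*} [CommRing R] {n : ℕ} {f : GL (Fin n) R → Matrix (Fin n) (Fin n) R}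

lemma transvection_conj_diagonal (w : Fin n → R) {i j : Fin n} (hij : i ≠ j) (a : R) :
    transvection i j a * diagonal w * transvection i j (-a) - diagonal w =
      single i j (a * (w j - w i)) := by
  rw [transvection, transvection]
  simp only [add_mul, mul_add, one_mul, mul_one]
  have h1 : single i j a * diagonal w = single i j (a * w j) := by
    ext k l
    rw [mul_diagonal]
    by_cases h : i = k ∧ j = l
    · obtain ⟨rfl, rfl⟩ := h
      simp
    · rw [single_apply_of_ne _ _ _ _ _ h, single_apply_of_ne _ _ _ _ _ h, zero_mul]
  have h2 : diagonal w * single i j (-a) = single i j (-(w i * a)) := by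
    ext k l
    rw [diagonal_mul]
    by_cases h : i = k ∧ j = l
    · obtain ⟨rfl, rfl⟩ := h
      simp
    · rw [single_apply_of_ne _ _ _ _ _ h, single_apply_of_ne _ _ _ _ _ h, mul_zero]
  rw [h1, h2, single_mul_single_of_ne _ _ _ _ hij.symm, add_zero, add_assoc, add_sub_cancel_left,
    ← single_add]
  congr 1
  ring

/-- Every cocycle is cohomologous to one that vanishes on the elementary matrices. -/
lemma exists_coboundary_elemUnit {p : ℕ} [Fact p.Prime] [IsDomain R] [IsLocalRing R]
    (hmax : IsLocalRing.maximalIdeal R = Ideal.span {(p : R)})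
    (hcomplete : IsAdicComplete (Ideal.span {(p : R)}) R)
    (hres : Nonempty ((R ⧸ Ideal.span {(p : R)}) ≃+* AlgebraicClosure (ZMod p)))
    (h2 : IsUnit (2 : R)) (hf : IsAdjointCocycle f) (i₀ : Fin n) :
    ∃ v : Matrix (Fin n) (Fin n) R, ∀ (i j : Fin n) (hij : i ≠ j) (a : R),
      f (elemUnit hij a) = (elemUnit hij a : GL (Fin n) R) * v *
        (((elemUnit hij a)⁻¹ : GL (Fin n) R) : Matrix (Fin n) (Fin n) R) - v := by
  obtain ⟨v, hv⟩ := hf.exists_coboundary_singleDiag_neg_one h2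
  have hf' := hf.sub_coboundary v
  let c : Fin n → Fin n → R := fun i j => if hij : i = j then 0 else
    (fun g : GL (Fin n) R => f g - ((g : Matrix (Fin n) (Fin n) R) * v *
      ((g⁻¹ : GL (Fin n) R) : Matrix (Fin n) (Fin n) R) - v)) (elemUnit hij 1) i j
  have hc := fun (i j : Fin n) (hij : i ≠ j) (a : R) =>
    (hf'.map_elemUnit_eq_single hmax hcomplete hres h2 (fun k => by simp [hv k]) hij a).trans
      (by simp only [c, dif_neg hij] :
        single i j (a * _) = single i j (a * c i j))
  -- the additivity of `c` makes it the coboundary of its row `i₀`, extended by `c i₀ i₀ = 0`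
  have hcw : ∀ i j, i ≠ j → c i₀ j - c i₀ i = c i j := by
    intro i j hij
    have h0 : c i₀ i₀ = 0 := dif_pos rfl
    by_cases hi : i₀ = i
    · subst hi
      rw [h0, sub_zero]
    by_cases hj : i₀ = j
    · subst hj
      linear_combination h0 - hf'.coeff_add_swap hc hi
    · linear_combination -hf'.coeff_add hc hi hij hj
  refine ⟨v + diagonal (c i₀), fun i j hij a => ?_⟩
  have h := hc i j hij a
  rw [← hcw i j hij, ← transvection_conj_diagonal _ hij] at h
  rw [sub_eq_iff_eq_add.1 h, coe_elemUnit, coe_elemUnit_inv, mul_add, add_mul]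
  abel

section Elementary

variable (hE : ∀ (i j : Fin n) (hij : i ≠ j) (a : R), f (elemUnit hij a) = 0)

include hE

/-- The elementary subgroup is normalized by the diagonal matrices, so that the values at the
latter are fixed by the elementary matrices, and hence are scalar. -/
lemma singleDiag_mem_range_scalar (hf : IsAdjointCocycle f) (k : Fin n) (d : Rˣ) :
    f (singleDiag k d) ∈ Set.range (Matrix.scalar (Fin n) : R → Matrix (Fin n) (Fin n) R) := by
  refine mem_range_scalar_iff_commute_single.2 fun i j hij => ?_
  let t : Fin n → Rˣ := Function.update 1 k d
  have h1 : diagUnit t * elemUnit hij ((((t i)⁻¹ : Rˣ) : R) * t j) =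
      elemUnit hij 1 * diagUnit t := by
    rw [← mul_inv_eq_iff_eq_mul, diagUnit_mul_elemUnit_mul_inv]
    simp
  have h2 := hf (diagUnit t) (elemUnit hij ((((t i)⁻¹ : Rˣ) : R) * t j))
  rw [h1, hf, hE, hE, mul_zero, zero_mul, zero_add, add_zero] at h2
  have h3 := congrArg (· * ((elemUnit hij (1 : R) : GL (Fin n) R) : Matrix (Fin n) (Fin n) R)) h2
  simp only [Units.inv_mul_cancel_right] at h3
  simp only [coe_elemUnit, transvection, add_mul, mul_add, one_mul, mul_one] at h3
  exact add_left_cancel h3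

/-- A cocycle that vanishes on the elementary matrices has scalar values, so it is a homomorphism,
and it is determined by its values on the matrices with a single diagonal entry.  The position of
this entry does not matter, because a homomorphism to a commutative group is invariant under
conjugation by the matrices that permute the coordinates. -/
lemma eq_smul_one_of_elemUnit_eq_zero [IsLocalRing R] (hf : IsAdjointCocycle f) (i₀ : Fin n)
    (g : GL (Fin n) R) :
    f g = f (singleDiag i₀ (GeneralLinearGroup.det g)) i₀ i₀ •
      (1 : Matrix (Fin n) (Fin n) R) := by
  have hadd : ∀ g h : GL (Fin n) R,
      f h ∈ Set.range (Matrix.scalar (Fin n) : R → Matrix (Fin n) (Fin n) R) →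
      f (g * h) = f g + f h := by
    rintro g h ⟨r, hr⟩
    rw [hf, ← hr, ← (Matrix.scalar_commute r (Commute.all r) _).eq, Units.mul_inv_cancel_right]
  have hneg : ∀ g : GL (Fin n) R,
      f g ∈ Set.range (Matrix.scalar (Fin n) : R → Matrix (Fin n) (Fin n) R) →
      f g⁻¹ = - f g := by
    intro g hg
    have h := hadd g⁻¹ g hg
    rw [inv_mul_cancel, hf.map_one] at h
    exact eq_neg_of_add_eq_zero_left h.symm
  let H : Subgroup (GL (Fin n) R) :=
    { carrier := {g | f g ∈ Set.range (Matrix.scalar (Fin n) : R → Matrix (Fin n) (Fin n) R)}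
      one_mem' := ⟨0, by rw [hf.map_one, _root_.map_zero]⟩
      mul_mem' := by
        rintro g h ⟨r, hr⟩ hh
        obtain ⟨s, hs⟩ := id hh
        exact ⟨r + s, by rw [hadd g h hh, _root_.map_add, hr, hs]⟩
      inv_mem' := by
        rintro g hg
        obtain ⟨r, hr⟩ := id hg
        exact ⟨-r, by rw [hneg g hg, _root_.map_neg, hr]⟩ }
  have hH : H = ⊤ := subgroup_eq_top_of_elemUnit_mem
    (fun i j hij a => ⟨0, by rw [hE, _root_.map_zero]⟩)
    (fun i d => singleDiag_mem_range_scalar hE hf i d)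
  have hscalar : ∀ g : GL (Fin n) R,
      f g ∈ Set.range (Matrix.scalar (Fin n) : R → Matrix (Fin n) (Fin n) R) := fun g => by
    have : g ∈ H := hH ▸ Subgroup.mem_top g
    exact this
  have hmul : ∀ g h : GL (Fin n) R, f (g * h) = f g + f h := fun g h => hadd g h (hscalar h)
  have hconj : ∀ i d, f (singleDiag i d) = f (singleDiag i₀ d) := by
    intro i d
    rcases eq_or_ne i i₀ with rfl | hi
    · rfl
    have h1 : GeneralLinearGroup.swap R i i₀ * singleDiag i d =
        singleDiag i₀ d * GeneralLinearGroup.swap R i i₀ := by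
      refine GeneralLinearGroup.ext fun k l => ?_
      rw [GeneralLinearGroup.coe_mul, GeneralLinearGroup.coe_mul, singleDiag, singleDiag,
        coe_diagUnit, coe_diagUnit]
      change (Matrix.swap R i i₀ * diagonal _ : Matrix (Fin n) (Fin n) R) k l =
        (diagonal _ * Matrix.swap R i i₀ : Matrix (Fin n) (Fin n) R) k l
      rw [mul_diagonal, diagonal_mul, Matrix.swap, Equiv.Perm.permMatrix,
        PEquiv.toMatrix_apply]
      by_cases h : Equiv.swap i i₀ k = l
      · subst h
        rcases eq_or_ne k i with rfl | hk
        · simp [hi, hi.symm]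
        rcases eq_or_ne k i₀ with rfl | hk'
        · simp
        · simp [Equiv.swap_apply_of_ne_of_ne hk hk', hk, hk']
      · simp [h]
    have h2 := congrArg f h1
    rw [hmul, hmul, add_comm] at h2
    exact add_right_cancel h2
  let D : Subgroup (GL (Fin n) R) :=
    { carrier := {g | f g = f (singleDiag i₀ (GeneralLinearGroup.det g))}
      one_mem' := by
        change f 1 = f _
        rw [_root_.map_one, singleDiag_one]
      mul_mem' := by
        intro g h (hg : f g = _) (hh : f h = _)
        change f _ = f _
        rw [_root_.map_mul, singleDiag_mul, hmul, hmul, hg, hh]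
      inv_mem' := by
        intro g (hg : f g = _)
        change f _ = f _
        have h1 : singleDiag i₀ (GeneralLinearGroup.det g⁻¹) =
            (singleDiag i₀ (GeneralLinearGroup.det g))⁻¹ := by
          rw [eq_inv_iff_mul_eq_one, ← singleDiag_mul, ← _root_.map_mul, inv_mul_cancel, _root_.map_one,
            singleDiag_one]
        rw [h1, hneg _ (hscalar _), hneg _ (hscalar _), hg] }
  have hD : D = ⊤ := subgroup_eq_top_of_elemUnit_mem
    (fun i j hij a => by
      change f _ = f _
      rw [hE, det_elemUnit, singleDiag_one, hf.map_one])
    (fun i d => by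
      change f _ = f _
      rw [det_singleDiag, hconj])
  have hgD : g ∈ D := hD ▸ Subgroup.mem_top g
  obtain ⟨r, hr⟩ := hscalar (singleDiag i₀ (GeneralLinearGroup.det g))
  have hgD' : f g = f (singleDiag i₀ (GeneralLinearGroup.det g)) := hgD
  rw [hgD', ← hr]
  ext k l
  simp [Matrix.scalar_apply, diagonal_apply, one_apply]

end Elementary

lemma singleDiag_conj_apply_self (i : Fin n) (d : Rˣ) (v : Matrix (Fin n) (Fin n) R) :
    ((singleDiag i d : GL (Fin n) R) * v *
      (((singleDiag i d)⁻¹ : GL (Fin n) R) : Matrix (Fin n) (Fin n) R)) i i = v i i := by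
  rw [singleDiag, conj_diagUnit_apply, mul_right_comm, Units.mul_inv, one_mul]

lemma singleDiag_mul_apply_self (hf : IsAdjointCocycle f) (i : Fin n) (a b : Rˣ) :
    f (singleDiag i (a * b)) i i = f (singleDiag i a) i i + f (singleDiag i b) i i := by
  rw [singleDiag_mul, hf, Matrix.add_apply, singleDiag_conj_apply_self]

/-- The first cohomology of the adjoint representation: up to coboundaries, a cocycle is a scalar
homomorphism that factors through the determinant. -/
theorem exists_eq_smul_one_add {p : ℕ} [Fact p.Prime] [IsDomain R] [IsLocalRing R]
    (hmax : IsLocalRing.maximalIdeal R = Ideal.span {(p : R)})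
    (hcomplete : IsAdicComplete (Ideal.span {(p : R)}) R)
    (hres : Nonempty ((R ⧸ Ideal.span {(p : R)}) ≃+* AlgebraicClosure (ZMod p)))
    (h2 : IsUnit (2 : R)) (hf : IsAdjointCocycle f) (i₀ : Fin n) :
    ∃ v : Matrix (Fin n) (Fin n) R, ∀ g : GL (Fin n) R,
      f g = f (singleDiag i₀ (GeneralLinearGroup.det g)) i₀ i₀ • (1 : Matrix (Fin n) (Fin n) R) +
        (g : Matrix (Fin n) (Fin n) R) * v *
          ((g⁻¹ : GL (Fin n) R) : Matrix (Fin n) (Fin n) R) - v := by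
  obtain ⟨v, hv⟩ := hf.exists_coboundary_elemUnit hmax hcomplete hres h2 i₀
  refine ⟨v, fun g => ?_⟩
  have h := eq_smul_one_of_elemUnit_eq_zero
    (fun i j hij a => sub_eq_zero.2 (hv i j hij a)) (hf.sub_coboundary v) i₀ g
  simp only [Matrix.sub_apply, singleDiag_conj_apply_self, sub_self, sub_zero] at h
  rw [sub_eq_iff_eq_add.1 h]
  abel

end IsAdjointCocycle

/-! ### Polynomial operations on δ-maps -/

section Approximation

variable {R : Type*} [CommRing R] {σ : Type*}

/-- `F` is approximated `p`-adically by polynomials whose values at `a` approximate `y`.  This is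
equivalent to `F` being restricted with value `y` at `a`, and visibly compatible with the ring
operations. -/
def ApproxEvalsTo (p : ℕ) (F : MvPowerSeries σ R) (a : σ → R) (y : R) : Prop :=
  ∀ m : ℕ, ∃ (P : MvPolynomial σ R) (H : MvPowerSeries σ R),
    F = (P : MvPowerSeries σ R) + MvPowerSeries.C ((p : R) ^ m) * H ∧ (p : R) ^ m ∣ y - MvPolynomial.eval a P

variable {p : ℕ} {F G : MvPowerSeries σ R} {a : σ → R} {y z : R}

lemma ApproxEvalsTo.of_isRestricted (hF : IsRestricted p F) (h : EvalsTo p F a y) :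
    ApproxEvalsTo p F a y := by
  classical
  intro m
  obtain ⟨T, hT⟩ := h m
  let S : Finset (σ →₀ ℕ) := T ∪ (hF m).toFinset
  let P : MvPolynomial σ R := ∑ s ∈ S, MvPolynomial.monomial s (MvPowerSeries.coeff s F)
  have hcoeff : ∀ s, P.coeff s = if s ∈ S then MvPowerSeries.coeff s F else 0 := fun s => by
    simp only [P, MvPolynomial.coeff_sum, MvPolynomial.coeff_monomial]
    rw [Finset.sum_ite_eq']
  have hdvd : ∀ s, (p : R) ^ m ∣ MvPowerSeries.coeff s F - P.coeff s := fun s => by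
    rw [hcoeff]
    split_ifs with hs
    · simp
    · rw [sub_zero]
      by_contra hn
      exact hs (Finset.mem_union_right _ ((hF m).mem_toFinset.2 hn))
  choose H hH using hdvd
  let H' : MvPowerSeries σ R := H
  refine ⟨P, H', ?_, ?_⟩
  · ext s
    rw [map_add, MvPolynomial.coeff_coe, MvPowerSeries.coeff_C_mul]
    exact sub_eq_iff_eq_add'.1 (hH s)
  · convert hT S Finset.subset_union_left using 2
    simp only [P, map_sum, MvPolynomial.eval_monomial]

lemma ApproxEvalsTo.isRestricted (h : ApproxEvalsTo p F a y) : IsRestricted p F := by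
  intro m
  obtain ⟨P, H, rfl, -⟩ := h m
  refine P.support.finite_toSet.subset fun s hs => ?_
  rw [Finset.mem_coe, MvPolynomial.mem_support_iff]
  intro h0
  refine hs ?_
  rw [map_add, MvPolynomial.coeff_coe, h0, zero_add, MvPowerSeries.coeff_C_mul]
  exact dvd_mul_right _ _

lemma ApproxEvalsTo.evalsTo (h : ApproxEvalsTo p F a y) : EvalsTo p F a y := by
  intro m
  obtain ⟨P, H, rfl, hP⟩ := h m
  refine ⟨P.support, fun S hS => ?_⟩
  have h1 : ∑ s ∈ S, MvPowerSeries.coeff s ((P : MvPowerSeries σ R) + MvPowerSeries.C ((p : R) ^ m) * H) *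
      s.prod (fun i e => a i ^ e) = MvPolynomial.eval a P +
        (p : R) ^ m * ∑ s ∈ S, MvPowerSeries.coeff s H * s.prod (fun i e => a i ^ e) := by
    simp only [map_add, MvPolynomial.coeff_coe, MvPowerSeries.coeff_C_mul, add_mul,
      Finset.sum_add_distrib, mul_assoc, Finset.mul_sum]
    congr 1
    rw [MvPolynomial.eval_eq, Finset.sum_subset hS]
    · rfl
    · intro s _ hs
      rw [MvPolynomial.notMem_support_iff.1 hs, zero_mul]
  rw [h1, ← sub_sub]
  exact dvd_sub hP (dvd_mul_right _ _)

lemma ApproxEvalsTo.C (r : R) : ApproxEvalsTo p (MvPowerSeries.C r) a r := fun m =>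
  ⟨MvPolynomial.C r, 0, by simp, by simp⟩

lemma ApproxEvalsTo.add (hF : ApproxEvalsTo p F a y) (hG : ApproxEvalsTo p G a z) :
    ApproxEvalsTo p (F + G) a (y + z) := by
  intro m
  obtain ⟨P, H, rfl, hP⟩ := hF m
  obtain ⟨Q, K, rfl, hQ⟩ := hG m
  refine ⟨P + Q, H + K, ?_, ?_⟩
  · push_cast
    ring
  · rw [map_add, add_sub_add_comm]
    exact dvd_add hP hQ

lemma ApproxEvalsTo.mul (hF : ApproxEvalsTo p F a y) (hG : ApproxEvalsTo p G a z) :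
    ApproxEvalsTo p (F * G) a (y * z) := by
  intro m
  obtain ⟨P, H, rfl, hP⟩ := hF m
  obtain ⟨Q, K, rfl, hQ⟩ := hG m
  refine ⟨P * Q, (P : MvPowerSeries σ R) * K + (Q : MvPowerSeries σ R) * H + MvPowerSeries.C ((p : R) ^ m) * (H * K), ?_, ?_⟩
  · push_cast
    ring
  · rw [map_mul]
    have : y * z - MvPolynomial.eval a P * MvPolynomial.eval a Q =
        (y - MvPolynomial.eval a P) * z + MvPolynomial.eval a P * (z - MvPolynomial.eval a Q) := by
      ring
    rw [this]
    exact dvd_add (hP.mul_right _) (hQ.mul_left _)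

lemma ApproxEvalsTo.aeval {τ : Type*} {F : τ → MvPowerSeries σ R} {y : τ → R}
    (h : ∀ j, ApproxEvalsTo p (F j) a (y j)) (Q : MvPolynomial τ R) :
    ApproxEvalsTo p (MvPolynomial.aeval F Q) a (MvPolynomial.aeval y Q) := by
  induction Q using MvPolynomial.induction_on with
  | C r =>
    rw [MvPolynomial.aeval_C, MvPolynomial.aeval_C]
    exact ApproxEvalsTo.C r
  | add P Q hP hQ =>
    rw [map_add, map_add]
    exact hP.add hQ
  | mul_X P j hP =>
    rw [map_mul, map_mul, MvPolynomial.aeval_X, MvPolynomial.aeval_X]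
    exact hP.mul (h j)

end Approximation

section Composition

variable {R : Type*} [CommRing R] {X X' Y : Type*}

/-- The pullback of functions along a map. -/
def pullback (R : Type*) [CommRing R] {X X' : Type*} (ι : X' → X) : (X → R) →ₐ[R] (X' → R) :=
  AlgHom.pi fun x => Pi.evalAlgHom R _ (ι x)

/-- A `δ`-map may be composed with a closed embedding `ι` (a map that is surjective on coordinate
rings) and with a regular function `h`. -/
lemma IsDeltaMap.comp_closedEmbedding [Nonempty X'] {p : ℕ} {δ : R → R}
    {OX : Subalgebra R (X → R)} {OX' : Subalgebra R (X' → R)} {OY : Subalgebra R (Y → R)}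
    {f : X → Y} (hf : IsDeltaMap p δ OX OY f) {ι : X' → X}
    (hι : OX.map (pullback R ι) = OX') {h : Y → R} (hh : h ∈ OY) :
    IsDeltaMap p δ OX' (coordGa R) fun x => h (f (ι x)) := by
  obtain ⟨r, N, M, e, e', F, he, he', hF, hev⟩ := hf
  have he : Algebra.adjoin R (Set.range e) = OX := he
  have he' : Algebra.adjoin R (Set.range e') = OY := he'
  rw [← he', Algebra.adjoin_range_eq_range_aeval] at hh
  obtain ⟨Q, rfl⟩ := hh
  have key : ∀ x : X', ApproxEvalsTo p (MvPolynomial.aeval F Q)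
      (fun ik => δ^[(ik.1 : ℕ)] (e ik.2 (ι x))) (MvPolynomial.aeval e' Q (f (ι x))) := fun x => by
    have h1 : MvPolynomial.aeval e' Q (f (ι x)) =
        MvPolynomial.aeval (fun j => e' j (f (ι x))) Q :=
      MvPolynomial.comp_aeval_apply (f := e') (φ := Pi.evalAlgHom R (fun _ : Y => R) (f (ι x))) Q
    rw [h1]
    exact ApproxEvalsTo.aeval (fun j => .of_isRestricted (hF j) (hev (ι x) j)) Q
  refine ⟨r, N, 1, fun k x => e k (ι x), fun _ y => y, fun _ => MvPolynomial.aeval F Q, ?_, ?_,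
    fun _ => (key (Classical.arbitrary X')).isRestricted, fun x _ => (key x).evalsTo⟩
  · rw [IsEmbedding, ← hι, ← he, AlgHom.map_adjoin, ← Set.range_comp]
    rfl
  · rw [IsEmbedding, coordGa, Set.range_const]

/-- The coordinate ring of the multiplicative group is a quotient of that of the general linear
group. -/
lemma map_coordGL_singleDiag {n : ℕ} (i : Fin n) :
    (coordGL R n).map (pullback R (singleDiag i)) = coordGm R := by
  rw [coordGL, AlgHom.map_adjoin, coordGm]
  have hu : (fun u : Rˣ => (u : R)) ∈ Algebra.adjoin R
      ({fun u : Rˣ => (u : R), fun u : Rˣ => ((u⁻¹ : Rˣ) : R)} : Set (Rˣ → R)) :=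
    Algebra.subset_adjoin (by simp)
  refine le_antisymm (Algebra.adjoin_le ?_) (Algebra.adjoin_le ?_)
  · rintro _ ⟨g, ⟨⟨k, l⟩, rfl⟩ | rfl, rfl⟩
    · have hentry : pullback R (singleDiag i)
          (fun g : GL (Fin n) R => (g : Matrix (Fin n) (Fin n) R) k l) =
          if k = l then if k = i then fun u : Rˣ => (u : R) else 1 else 0 := by
        ext u
        split_ifs with hkl hk
        · simp [pullback, singleDiag, coe_diagUnit, ← hkl, hk]
        · simp [pullback, singleDiag, coe_diagUnit, ← hkl, hk]
        · simp [pullback, singleDiag, coe_diagUnit, hkl]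
      rw [SetLike.mem_coe]
      refine hentry ▸ ?_
      split_ifs
      exacts [hu, one_mem _, zero_mem _]
    · refine Algebra.subset_adjoin (Or.inr ?_)
      ext u
      change ((Matrix.GeneralLinearGroup.det (singleDiag i u))⁻¹ : Rˣ).val = _
      rw [det_singleDiag]
  · rintro _ (rfl | rfl)
    · refine Algebra.subset_adjoin ⟨_, Or.inl ⟨(i, i), rfl⟩, ?_⟩
      ext u
      simp [pullback, singleDiag, coe_diagUnit]
    · refine Algebra.subset_adjoin ⟨_, Or.inr rfl, ?_⟩
      ext u
      change ((Matrix.GeneralLinearGroup.det (singleDiag i u))⁻¹ : Rˣ).val = _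
      rw [det_singleDiag]

lemma isDeltaHomGmGa_singleDiag {p : ℕ} {δ : R → R} {n : ℕ}
    {f : GL (Fin n) R → Matrix (Fin n) (Fin n) R} (hf : IsClassicalDeltaCocycle p δ f)
    (i : Fin n) : IsDeltaHomGmGa p δ fun d => f (singleDiag i d) i i where
  isDeltaMap := hf.isDeltaMap.comp_closedEmbedding (map_coordGL_singleDiag i)
    (h := fun x => x i i) (Algebra.subset_adjoin ⟨(i, i), rfl⟩)
  map_mul := IsAdjointCocycle.singleDiag_mul_apply_self hf.cocycle i

lemma isDeltaHomGmGa_zero (p : ℕ) (δ : R → R) : IsDeltaHomGmGa p δ fun _ => 0 where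
  isDeltaMap := by
    have h0 : ∀ a : Fin (0 + 1) × Fin 2 → R, ApproxEvalsTo p 0 a 0 := fun a => by
      simpa using ApproxEvalsTo.C (p := p) (a := a) (0 : R)
    refine ⟨0, 2, 1, ![fun u => (u : R), fun u => ((u⁻¹ : Rˣ) : R)], fun _ y => y, fun _ => 0,
      ?_, ?_, fun _ => (h0 0).isRestricted, fun _ _ => (h0 _).evalsTo⟩
    · rw [IsEmbedding, coordGm]
      congr 1
      simp [Matrix.range_cons, Set.pair_comm]
    · rw [IsEmbedding, coordGa, Set.range_const]
  map_mul := by simp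

end Composition

end DeltaArith

theorem theorem1p1 (p : ℕ) [Fact p.Prime] (hp2 : p ≠ 2)
    {R : Type*} [CommRing R] [IsDomain R] [IsDiscreteValuationRing R]
    (hmax : IsLocalRing.maximalIdeal R = Ideal.span {(p : R)})
    (hcomplete : IsAdicComplete (Ideal.span {(p : R)}) R)
    (hres : Nonempty ((R ⧸ Ideal.span {(p : R)}) ≃+* AlgebraicClosure (ZMod p)))
    (φ : R →+* R) (δ : R → R) (hδ : ∀ x : R, (p : R) * δ x = φ x - x ^ p)
    (n : ℕ) (f : GL (Fin n) R → Matrix (Fin n) (Fin n) R)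
    (hf : DeltaArith.IsClassicalDeltaCocycle p δ f) :
    ∃ ω : Rˣ → R, DeltaArith.IsDeltaHomGmGa p δ ω ∧
      ∃ v : Matrix (Fin n) (Fin n) R, ∀ g : GL (Fin n) R,
        f g = ω (Matrix.GeneralLinearGroup.det g) • (1 : Matrix (Fin n) (Fin n) R) +
          (g : Matrix (Fin n) (Fin n) R) * v *
            ((g⁻¹ : GL (Fin n) R) : Matrix (Fin n) (Fin n) R) - v := by
  obtain _ | n := n
  -- `gl_0` is zero, and there is no diagonal entry to define `ω`
  · exact ⟨fun _ => 0, DeltaArith.isDeltaHomGmGa_zero p δ, 0, fun g => Subsingleton.elim _ _⟩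
  have h2 : IsUnit (2 : R) := by
    obtain ⟨k, hk⟩ := (Fact.out : p.Prime).odd_of_ne_two hp2
    have h1 : (p : R) = 2 * k + 1 := by
      rw [hk]
      push_cast
      ring
    refine isUnit_of_mul_isUnit_left (y := -(k : R)) ?_
    exact DeltaArith.isUnit_of_dvd_sub hmax isUnit_one ⟨1, by rw [h1]; ring⟩
  have hcocycle : DeltaArith.IsAdjointCocycle f := hf.cocycle
  exact ⟨_, DeltaArith.isDeltaHomGmGa_singleDiag hf 0,
    hcocycle.exists_eq_smul_one_add hmax hcomplete hres h2 0⟩
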